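/- Let $n\ge 1$ and let $k_1,\dots,k_n\ge 2$ be integers. Let $\Gamma_1$ be the graph obtained by gluing $n$ cycles, the $j$-th one having $k_j+1$ vertices, at one common vertex (the root), and let $\Gamma$ be obtained from $\Gamma_1$ by joining the root by a new edge to the first vertex of a one-sided infinite path. Let $A(\Gamma)$ be the adjacency operator of $\Gamma$ on $\ell^2$ of the vertex set, and let the discrete spectrum $\sigma_d(\Gamma)$ be the set of eigenvalues of $A(\Gamma)$ of finite multiplicity lying off $[-2,2]$. Then the equation $$2\sum_{j=1}^n\frac{\sinh (k_jt)+\sinh t}{\sinh((k_j+1)t)}=e^t,\qquad t>0,$$ has a unique solution $t_+$, and $\lambda_+:=2\cosh t_+\in\sigma_d(\Gamma)$. If, moreover, $\Gamma_1$ is not a single triangle (that is, unless $n=1$ and $k_1=2$), then the equation $$2\sum_{j=1}^n\frac{\sinh (k_jt)+(-1)^{k_j+1}\sinh t}{\sinh((k_j+1)t)}=e^t,\qquad t>0,$$ has a unique solution $t_-$, and with $\lambda_-:=-2\cosh t_-$ one has $$\sigma_d(\Gamma)=\{\lambda_+,\lambda_-\}.$$ -/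

import Mathlib

noncomputable section

namespace FlowerGraph

/-! ### Adjacency operator of a uniformly locally finite graph -/

/-- The complex Hilbert space `ℓ²(V)`. -/
abbrev EllTwo (V : Type*) : Type _ := lp (fun _ : V => ℂ) 2

/-- The degrees of the vertices are finite and uniformly bounded. -/
def UniformlyLocallyFinite {V : Type*} (G : SimpleGraph V) : Prop :=
  ∃ d : ℕ, ∀ v, (G.neighborSet v).encard ≤ d

/-- The action of the adjacency matrix on a function: `(A f)(v) = ∑_{w ∼ v} f(w)`. -/
def adjFun {V : Type*} (G : SimpleGraph V) (f : V → ℂ) (v : V) : ℂ :=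
  ∑ᶠ w ∈ G.neighborSet v, f w

theorem neighborSet_finite {V : Type*} {G : SimpleGraph V} (hG : UniformlyLocallyFinite G)
    (v : V) : (G.neighborSet v).Finite := by
  obtain ⟨d, hd⟩ := hG
  exact Set.finite_of_encard_le_coe (hd v)

theorem adjFun_eq_sum {V : Type*} {G : SimpleGraph V} (hG : UniformlyLocallyFinite G)
    (f : V → ℂ) (v : V) :
    adjFun G f v = ∑ w ∈ (neighborSet_finite hG v).toFinset, f w :=
  finsum_mem_eq_finite_toFinset_sum _ _

theorem sum_adjFun_le {V : Type*} {G : SimpleGraph V} (hG : UniformlyLocallyFinite G)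
    {d : ℕ} (hd : ∀ v, (G.neighborSet v).encard ≤ d) (f : EllTwo V) (s : Finset V) :
    ∑ v ∈ s, ‖adjFun G f v‖ ^ (2 : ENNReal).toReal ≤ (d * ‖f‖) ^ (2 : ENNReal).toReal := by
  classical
  set N : V → Finset V := fun v => (neighborSet_finite hG v).toFinset with hN
  have hmem : ∀ v w, w ∈ N v ↔ G.Adj v w := fun v w => by simp [hN]
  have hcard : ∀ v, ((N v).card : ℝ) ≤ d := fun v => by
    have h := hd v
    rw [(neighborSet_finite hG v).encard_eq_coe_toFinset_card] at h
    exact_mod_cast h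
  have hf : ∀ t : Finset V, ∑ w ∈ t, ‖f w‖ ^ 2 ≤ ‖f‖ ^ 2 := fun t => by
    simpa using lp.sum_rpow_le_norm_rpow (p := 2) (by simp) f t
  have h1 : ∀ v, ‖adjFun G f v‖ ^ 2 ≤ d * ∑ w ∈ N v, ‖f w‖ ^ 2 := fun v => by
    rw [adjFun_eq_sum hG]
    calc ‖∑ w ∈ N v, f w‖ ^ 2 ≤ (∑ w ∈ N v, ‖f w‖) ^ 2 := by
          gcongr
          exact norm_sum_le _ _
      _ ≤ (N v).card * ∑ w ∈ N v, ‖f w‖ ^ 2 := sq_sum_le_card_mul_sum_sq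
      _ ≤ d * ∑ w ∈ N v, ‖f w‖ ^ 2 := by
          gcongr
          exact_mod_cast hcard v
  have h2 : ∑ v ∈ s, ∑ w ∈ N v, ‖f w‖ ^ 2 ≤ d * ‖f‖ ^ 2 := by
    calc ∑ v ∈ s, ∑ w ∈ N v, ‖f w‖ ^ 2
        = ∑ w ∈ s.biUnion N, ∑ v ∈ s with w ∈ N v, ‖f w‖ ^ 2 := by
          apply Finset.sum_comm'
          intro v w
          simp only [Finset.mem_biUnion, Finset.mem_filter]
          constructor
          · rintro ⟨a, b⟩
            exact ⟨⟨a, b⟩, v, a, b⟩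
          · rintro ⟨a, -⟩
            exact a
      _ ≤ ∑ w ∈ s.biUnion N, d * ‖f w‖ ^ 2 := by
          apply Finset.sum_le_sum
          intro w _
          rw [Finset.sum_const, nsmul_eq_mul]
          gcongr
          refine le_trans ?_ (show (N w).card ≤ d by exact_mod_cast hcard w)
          apply Finset.card_le_card
          intro v hv
          rw [Finset.mem_filter, hmem] at hv
          rw [hmem]
          exact hv.2.symm
      _ = d * ∑ w ∈ s.biUnion N, ‖f w‖ ^ 2 := by rw [Finset.mul_sum]
      _ ≤ d * ‖f‖ ^ 2 := by
          gcongr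
          exact hf _
  simp only [ENNReal.toReal_ofNat, Real.rpow_ofNat]
  calc ∑ v ∈ s, ‖adjFun G f v‖ ^ 2 ≤ ∑ v ∈ s, d * ∑ w ∈ N v, ‖f w‖ ^ 2 :=
        Finset.sum_le_sum fun v _ => h1 v
    _ = d * ∑ v ∈ s, ∑ w ∈ N v, ‖f w‖ ^ 2 := by rw [Finset.mul_sum]
    _ ≤ d * (d * ‖f‖ ^ 2) := by gcongr
    _ = (d * ‖f‖) ^ 2 := by ring

theorem memℓp_adjFun {V : Type*} {G : SimpleGraph V} (hG : UniformlyLocallyFinite G)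
    (f : EllTwo V) : Memℓp (fun v => adjFun G f v) 2 := by
  obtain ⟨d, hd⟩ := id hG
  exact memℓp_gen' (sum_adjFun_le hG hd f)

/-- The adjacency operator, as a bounded operator on `ℓ²(V)`. -/
def adjacencyOperator {V : Type*} (G : SimpleGraph V) (hG : UniformlyLocallyFinite G) :
    EllTwo V →L[ℂ] EllTwo V :=
  LinearMap.mkContinuousOfExistsBound
    { toFun := fun f => ⟨fun v => adjFun G f v, memℓp_adjFun hG f⟩
      map_add' := fun f g => by
        ext v
        change adjFun G (fun w => f w + g w) v = adjFun G f v + adjFun G g v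
        simp only [adjFun_eq_sum hG, Finset.sum_add_distrib]
      map_smul' := fun c f => by
        ext v
        change adjFun G (fun w => c * f w) v = c * adjFun G f v
        simp only [adjFun_eq_sum hG, Finset.mul_sum] }
    (by
      obtain ⟨d, hd⟩ := id hG
      exact ⟨d, fun f => lp.norm_le_of_forall_sum_le (by simp) (by positivity)
        (sum_adjFun_le hG hd f)⟩)

theorem adjacencyOperator_apply {V : Type*} (G : SimpleGraph V)
    (hG : UniformlyLocallyFinite G) (f : EllTwo V) (v : V) :
    adjacencyOperator G hG f v = ∑ᶠ w ∈ G.neighborSet v, f w := rfl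

/-- For a finite graph with a ray attached, whose essential spectrum is `[-2, 2]`, the discrete
spectrum is the set of eigenvalues of finite multiplicity off `[-2, 2]`. -/
def discreteSpectrum {V : Type*} (T : EllTwo V →L[ℂ] EllTwo V) : Set ℂ :=
  {l | Module.End.HasEigenvalue (T : EllTwo V →ₗ[ℂ] EllTwo V) l ∧
    FiniteDimensional ℂ (Module.End.eigenspace (T : EllTwo V →ₗ[ℂ] EllTwo V) l) ∧
    l ∉ (fun x : ℝ => (x : ℂ)) '' Set.Icc (-2) 2}

/-! ### The flower with a ray attached to its root -/

/-- The coupling of two graphs by means of the bridge `{v, w}`. -/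
def coupling {V W : Type*} (G : SimpleGraph V) (H : SimpleGraph W) (v : V) (w : W) :
    SimpleGraph (V ⊕ W) :=
  (G ⊕g H) ⊔ SimpleGraph.edge (Sum.inl v) (Sum.inr w)

/-- The one-sided infinite path `0 - 1 - 2 - ⋯`. -/
def ray : SimpleGraph ℕ := SimpleGraph.hasse ℕ

/-- Vertices of the flower: the root `none`, and for every `j` the `k j` vertices of the `j`-th
cycle other than the root. -/
abbrev FlowerVertex {n : ℕ} (k : Fin n → ℕ) : Type := Option (Σ j : Fin n, Fin (k j))

/-- The `j`-th cycle, with vertices `0, …, k j`, inside the flower; `0` goes to the root. -/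
def petal {n : ℕ} (k : Fin n → ℕ) (j : Fin n) : Fin (k j + 1) ↪ FlowerVertex k where
  toFun := Fin.cases none (fun i => some ⟨j, i⟩)
  inj' := by
    intro a b
    refine Fin.cases ?_ (fun a => ?_) a <;> refine Fin.cases ?_ (fun b => ?_) b <;> simp

/-- `n` cycles, the `j`-th one with `k j + 1` vertices, glued together at one common vertex. -/
def flower {n : ℕ} (k : Fin n → ℕ) : SimpleGraph (FlowerVertex k) :=
  ⨆ j : Fin n, (SimpleGraph.cycleGraph (k j + 1)).map (petal k j)

/-- The flower with the infinite path attached to its root. -/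
def flowerWithRay {n : ℕ} (k : Fin n → ℕ) : SimpleGraph (FlowerVertex k ⊕ ℕ) :=
  coupling (flower k) ray none 0

theorem uniformlyLocallyFinite_of_finite {V : Type*} [Finite V] (G : SimpleGraph V) :
    UniformlyLocallyFinite G := by
  refine ⟨Nat.card V, fun v => ?_⟩
  rw [← ENat.card_eq_coe_natCard V, ← Set.encard_univ V]
  exact Set.encard_le_encard (Set.subset_univ _)

theorem uniformlyLocallyFinite_ray : UniformlyLocallyFinite ray := by
  refine ⟨2, fun v => ?_⟩
  refine le_trans (Set.encard_le_encard (t := {v + 1, v - 1}) ?_)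
    ((Set.encard_insert_le _ _).trans (by rw [Set.encard_singleton]; norm_num))
  intro w hw
  simp only [ray, SimpleGraph.mem_neighborSet, SimpleGraph.hasse_adj, Nat.covBy_iff_add_one_eq]
    at hw
  simp only [Set.mem_insert_iff, Set.mem_singleton_iff]
  omega

theorem uniformlyLocallyFinite_coupling {V W : Type*} {G : SimpleGraph V} {H : SimpleGraph W}
    (hG : UniformlyLocallyFinite G) (hH : UniformlyLocallyFinite H) (v : V) (w : W) :
    UniformlyLocallyFinite (coupling G H v w) := by
  obtain ⟨a, ha⟩ := hG
  obtain ⟨b, hb⟩ := hH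
  refine ⟨a + b + 1, ?_⟩
  rintro (x | x)
  · have hsub : (coupling G H v w).neighborSet (Sum.inl x) ⊆
        (Sum.inl '' G.neighborSet x) ∪ {Sum.inr w} := by
      rintro (y | y) hy <;>
        simp_all [coupling, SimpleGraph.edge_adj]
    calc _ ≤ _ := Set.encard_le_encard hsub
      _ ≤ (Sum.inl '' G.neighborSet x : Set (V ⊕ W)).encard + 1 := by
          simpa using Set.encard_union_le (Sum.inl '' G.neighborSet x : Set (V ⊕ W)) {Sum.inr w}
      _ ≤ (a : ℕ∞) + 1 := by
          gcongr
          exact (Set.encard_image_le _ _).trans (ha x)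
      _ ≤ _ := by norm_cast; omega
  · have hsub : (coupling G H v w).neighborSet (Sum.inr x) ⊆
        (Sum.inr '' H.neighborSet x) ∪ {Sum.inl v} := by
      rintro (y | y) hy <;>
        simp_all [coupling, SimpleGraph.edge_adj]
    calc _ ≤ _ := Set.encard_le_encard hsub
      _ ≤ (Sum.inr '' H.neighborSet x : Set (V ⊕ W)).encard + 1 := by
          simpa using Set.encard_union_le (Sum.inr '' H.neighborSet x : Set (V ⊕ W)) {Sum.inl v}
      _ ≤ (b : ℕ∞) + 1 := by
          gcongr
          exact (Set.encard_image_le _ _).trans (hb x)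
      _ ≤ _ := by norm_cast; omega

theorem uniformlyLocallyFinite_flowerWithRay {n : ℕ} (k : Fin n → ℕ) :
    UniformlyLocallyFinite (flowerWithRay k) :=
  uniformlyLocallyFinite_coupling (uniformlyLocallyFinite_of_finite _)
    uniformlyLocallyFinite_ray none 0

/-- The discrete spectrum of the flower with the infinite path attached to its root. -/
def flowerDiscreteSpectrum {n : ℕ} (k : Fin n → ℕ) : Set ℂ :=
  discreteSpectrum (adjacencyOperator (flowerWithRay k) (uniformlyLocallyFinite_flowerWithRay k))

end FlowerGraph

end

/-!
Write an eigenvalue off `[-2, 2]` as `z + z⁻¹` with `0 < ‖z‖ < 1`. A square-summable eigenfunction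
decays along the ray like `z ^ m`, so the ray acts on the flower as the potential `z` at the root.
On each petal the eigenvalue equation with equal values at both ends has only one solution up to
scaling, the symmetric one `z ^ i + z ^ (k + 1 - i)`, because the Dirichlet solution
`z ^ i - z⁻¹ ^ i` does not vanish at `k + 1`. Hence eigenspaces are at most lines, and all that
remains of the eigenvalue equation is the one at the root, `2 * ∑ j, xⱼ = z⁻¹`, with `xⱼ` the value
next to the root on the `j`-th petal when the root has value `1`.

Self-adjointness makes `z` real, and `z = ±exp (-t)` turns the equation at the root into the two
equations between hyperbolic functions. Multiplied by `z`, it says that a sum of petal weights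
equals `1 / 2`. Each weight vanishes at `z = 0` and is strictly increasing in `|z|` on either side,
by convexity of power functions, so there is at most one solution of each sign; it exists as soon
as the weights exceed `1 / 2` near `|z| = 1`, which for negative `z` fails only for a triangle.
-/

namespace FlowerGraph

section Adjacency

variable {V W : Type*} {G : SimpleGraph V} {H : SimpleGraph W}

theorem mem_eigenspace_adjacencyOperator_iff (hG : UniformlyLocallyFinite G) {l : ℂ}
    {f : EllTwo V} :
    f ∈ Module.End.eigenspace (adjacencyOperator G hG : EllTwo V →ₗ[ℂ] EllTwo V) l ↔
      ∀ v, adjFun G f v = l * f v := by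
  rw [Module.End.mem_eigenspace_iff]
  exact ⟨fun h v => congrArg (fun g : EllTwo V => g v) h, fun h => lp.ext (funext h)⟩

theorem adjacencyOperator_single [DecidableEq V] (hG : UniformlyLocallyFinite G) (v : V) :
    adjacencyOperator G hG (lp.single 2 v 1) =
      ∑ w ∈ (neighborSet_finite hG v).toFinset, lp.single 2 w 1 := by
  ext u
  change adjFun G _ u = _
  rw [adjFun_eq_sum hG, lp.coeFn_sum, Finset.sum_apply]
  have hmem : v ∈ (neighborSet_finite hG u).toFinset ↔ u ∈ (neighborSet_finite hG v).toFinset := by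
    simp only [Set.Finite.mem_toFinset, SimpleGraph.mem_neighborSet, G.adj_comm]
  simpa [Pi.single_apply] using if_congr hmem rfl rfl

theorem isSelfAdjoint_adjacencyOperator (hG : UniformlyLocallyFinite G) :
    IsSelfAdjoint (adjacencyOperator G hG) := by
  classical
  rw [ContinuousLinearMap.isSelfAdjoint_iff']
  ext f v
  set A := adjacencyOperator G hG
  calc (ContinuousLinearMap.adjoint A) f v
      = inner ℂ (lp.single 2 v 1) (ContinuousLinearMap.adjoint A f) := by
        rw [lp.inner_single_left, RCLike.inner_apply, map_one, mul_one]
    _ = ∑ w ∈ (neighborSet_finite hG v).toFinset, inner ℂ (lp.single 2 w 1) f := by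
        rw [ContinuousLinearMap.adjoint_inner_right, adjacencyOperator_single, sum_inner]
    _ = A f v := by
        simp only [lp.inner_single_left, RCLike.inner_apply, map_one, mul_one]
        exact (adjFun_eq_sum hG f v).symm

theorem exists_ofReal_eq_of_hasEigenvalue (hG : UniformlyLocallyFinite G) {l : ℂ}
    (hl : Module.End.HasEigenvalue (adjacencyOperator G hG : EllTwo V →ₗ[ℂ] EllTwo V) l) :
    ∃ x : ℝ, (x : ℂ) = l :=
  Complex.conj_eq_iff_real.1
    ((isSelfAdjoint_adjacencyOperator hG).isSymmetric.conj_eigenvalue_eq_self hl) |>.imp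
      fun _ => Eq.symm

theorem adjFun_coupling_inl [DecidableEq V] (hG : UniformlyLocallyFinite G) (v : V) (w : W)
    (f : V ⊕ W → ℂ) (x : V) :
    adjFun (coupling G H v w) f (Sum.inl x) =
      adjFun G (f ∘ Sum.inl) x + (Pi.single v (f (Sum.inr w)) : V → ℂ) x := by
  have hset : (coupling G H v w).neighborSet (Sum.inl x) =
      Sum.inl '' G.neighborSet x ∪ if x = v then {Sum.inr w} else ∅ := by
    ext (y | y) <;> split_ifs with h <;> simp [coupling, SimpleGraph.edge_adj, h]
  rw [adjFun, hset, finsum_mem_union, finsum_mem_image Sum.inl_injective.injOn, Pi.single_apply]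
  · split_ifs <;> simp [adjFun]
  · split_ifs <;> simp
  · exact (neighborSet_finite hG x).image _
  · split_ifs <;> simp

theorem adjFun_coupling_inr [DecidableEq W] (hH : UniformlyLocallyFinite H) (v : V) (w : W)
    (f : V ⊕ W → ℂ) (y : W) :
    adjFun (coupling G H v w) f (Sum.inr y) =
      adjFun H (f ∘ Sum.inr) y + (Pi.single w (f (Sum.inl v)) : W → ℂ) y := by
  have hset : (coupling G H v w).neighborSet (Sum.inr y) =
      Sum.inr '' H.neighborSet y ∪ if y = w then {Sum.inl v} else ∅ := by
    ext (x | x) <;> split_ifs with h <;> simp [coupling, SimpleGraph.edge_adj, h]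
  rw [adjFun, hset, finsum_mem_union, finsum_mem_image Sum.inr_injective.injOn, Pi.single_apply]
  · split_ifs <;> simp [adjFun]
  · split_ifs <;> simp
  · exact (neighborSet_finite hH y).image _
  · split_ifs <;> simp

theorem adjFun_map (e : V ↪ W) (f : W → ℂ) (v : V) :
    adjFun (G.map e) f (e v) = adjFun G (f ∘ e) v := by
  rw [adjFun, SimpleGraph.neighborSet_map, finsum_mem_image e.injective.injOn]
  rfl

theorem adjFun_map_of_notMem_range (e : V ↪ W) (f : W → ℂ) {w : W} (hw : w ∉ Set.range e) :
    adjFun (G.map e) f w = 0 := by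
  have hset : (G.map e).neighborSet w = ∅ := by
    refine Set.eq_empty_of_forall_notMem fun u hu => ?_
    obtain ⟨a, -, -, rfl, -⟩ := (SimpleGraph.map_adj e G w u).1 hu
    exact hw ⟨a, rfl⟩
  rw [adjFun, hset, finsum_mem_empty]

theorem adjFun_iSup {ι : Type*} [Fintype ι] {F : ι → SimpleGraph V}
    (hF : ∀ i, UniformlyLocallyFinite (F i)) (hdisj : Pairwise (Function.onFun Disjoint F))
    (f : V → ℂ) (v : V) : adjFun (⨆ i, F i) f v = ∑ i, adjFun (F i) f v := by
  rw [adjFun, SimpleGraph.neighborSet_iSup, finsum_mem_iUnion, finsum_eq_sum_of_fintype]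
  · rfl
  · exact fun i j hij => Set.disjoint_left.2 fun w => SimpleGraph.disjoint_left.1 (hdisj hij) v w
  · exact fun i => neighborSet_finite (hF i) v

theorem adjFun_ray_zero (f : ℕ → ℂ) : adjFun ray f 0 = f 1 := by
  have hset : ray.neighborSet 0 = {1} := by
    ext m
    simp only [ray, SimpleGraph.mem_neighborSet, SimpleGraph.hasse_adj,
      Nat.covBy_iff_add_one_eq, Set.mem_singleton_iff]
    omega
  rw [adjFun, hset, finsum_mem_singleton]

theorem adjFun_ray_succ (f : ℕ → ℂ) (m : ℕ) : adjFun ray f (m + 1) = f m + f (m + 2) := by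
  have hset : ray.neighborSet (m + 1) = {m, m + 2} := by
    ext i
    simp only [ray, SimpleGraph.mem_neighborSet, SimpleGraph.hasse_adj,
      Nat.covBy_iff_add_one_eq, Set.mem_singleton_iff, Set.mem_insert_iff]
    omega
  rw [adjFun, hset, finsum_mem_pair (by omega)]

open scoped Fin.CommRing in
theorem adjFun_cycleGraph {k : ℕ} (hk : 2 ≤ k) (g : Fin (k + 1) → ℂ) (i : ℕ) :
    adjFun (SimpleGraph.cycleGraph (k + 1)) g (Fin.ofNat (k + 1) (i + 1)) =
      g (Fin.ofNat (k + 1) i) + g (Fin.ofNat (k + 1) (i + 2)) := by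
  obtain ⟨m, rfl⟩ := Nat.exists_eq_add_of_le' hk
  have hcast (a : ℕ) : Fin.ofNat (m + 2 + 1) a = (a : Fin (m + 2 + 1)) := rfl
  have hset : (SimpleGraph.cycleGraph (m + 2 + 1)).neighborSet (Fin.ofNat _ (i + 1)) =
      {Fin.ofNat _ i, Fin.ofNat _ (i + 2)} := by
    rw [SimpleGraph.cycleGraph_neighborSet]
    simp only [hcast]
    push_cast
    ring_nf
  have hne : Fin.ofNat (m + 2 + 1) i ≠ Fin.ofNat _ (i + 2) := by
    simp only [hcast]
    push_cast
    rw [ne_eq, left_eq_add]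
    exact fun h => by simpa [Nat.mod_eq_of_lt] using congrArg Fin.val h
  rw [adjFun, hset, finsum_mem_pair hne]

theorem tendsto_cofinite_zero (f : EllTwo V) : Filter.Tendsto f Filter.cofinite (nhds 0) := by
  have hsq : Filter.Tendsto (fun v => ‖f v‖ ^ 2) Filter.cofinite (nhds 0) := by
    simpa using ((lp.memℓp f).summable (by simp)).tendsto_cofinite_zero
  simpa [tendsto_zero_iff_norm_tendsto_zero] using hsq.sqrt

end Adjacency

section Recurrence

/-- The eigenvalue equation of a path at its interior vertices `1, …, k`; nothing is required
of `x` at the end points `0` and `k + 1`. -/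
def IsPathSolution {R : Type*} [Ring R] (l : R) (k : ℕ) (x : ℕ → R) : Prop :=
  ∀ i < k, x i + x (i + 2) = l * x (i + 1)

namespace IsPathSolution

theorem sub {R : Type*} [Ring R] {l : R} {k : ℕ} {x y : ℕ → R} (hx : IsPathSolution l k x)
    (hy : IsPathSolution l k y) : IsPathSolution l k (x - y) := fun i hi => by
  simp only [Pi.sub_apply, mul_sub, ← hx i hi, ← hy i hi]
  abel

variable {R : Type*} [CommRing R] {l : R} {k : ℕ} {x y : ℕ → R}

theorem const_mul (hx : IsPathSolution l k x) (c : R) :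
    IsPathSolution l k fun i => c * x i := fun i hi => by
  linear_combination c * hx i hi

theorem eqOn_of_initial (hx : IsPathSolution l k x) (hy : IsPathSolution l k y)
    (h0 : x 0 = y 0) (h1 : x 1 = y 1) {i : ℕ} (hi : i ≤ k + 1) : x i = y i := by
  induction i using Nat.twoStepInduction with
  | zero => exact h0
  | one => exact h1
  | more i ih ih' =>
    linear_combination hx i (by omega) - hy i (by omega) + l * ih' (by omega) - ih (by omega)

theorem eqOn_zero_of_boundary [IsDomain R] {u : ℕ → R} (hu : IsPathSolution l k u)
    (hu0 : u 0 = 0) (huk : u (k + 1) ≠ 0) (hx : IsPathSolution l k x) (hx0 : x 0 = 0)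
    (hxk : x (k + 1) = 0) {i : ℕ} (hi : i ≤ k + 1) : x i = 0 := by
  have hprop : u 1 * x (k + 1) = x 1 * u (k + 1) :=
    eqOn_of_initial (hx.const_mul (u 1)) (hu.const_mul (x 1)) (by rw [hx0, hu0, mul_zero, mul_zero])
      (mul_comm _ _) le_rfl
  have hx1 : x 1 = 0 := by
    rw [hxk, mul_zero] at hprop
    exact (mul_eq_zero.1 hprop.symm).resolve_right huk
  exact eqOn_of_initial (y := 0) hx (fun i _ => by simp) hx0 hx1 hi

theorem eqOn_of_boundary [IsDomain R] {u : ℕ → R} (hu : IsPathSolution l k u)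
    (hu0 : u 0 = 0) (huk : u (k + 1) ≠ 0) (hx : IsPathSolution l k x) (hy : IsPathSolution l k y)
    (h0 : x 0 = y 0) (hk : x (k + 1) = y (k + 1)) {i : ℕ} (hi : i ≤ k + 1) : x i = y i :=
  sub_eq_zero.1 <|
    eqOn_zero_of_boundary hu hu0 huk (hx.sub hy) (sub_eq_zero.2 h0) (sub_eq_zero.2 hk) hi

end IsPathSolution

theorem isPathSolution_pow {K : Type*} [Field K] {z : K} (hz : z ≠ 0) (k : ℕ) :
    IsPathSolution (z + z⁻¹) k fun i => z ^ i := fun i _ => by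
  field_simp
  ring

theorem eq_mul_pow_of_tendsto_zero {𝕜 : Type*} [NormedField 𝕜] {z : 𝕜} (hz0 : z ≠ 0)
    (hz1 : ‖z‖ ≤ 1) {y : ℕ → 𝕜} (hy : ∀ m, y m + y (m + 2) = (z + z⁻¹) * y (m + 1))
    (hlim : Filter.Tendsto y Filter.atTop (nhds 0)) (m : ℕ) : y m = y 0 * z ^ m := by
  set g : ℕ → 𝕜 := fun m => y (m + 1) - z * y m with hg
  -- `g` is a solution proportional to the growing one `z⁻¹ ^ m`, so it must vanish
  have hinvariant (m : ℕ) : z ^ m * g m = g 0 := by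
    induction m with
    | zero => simp
    | succ m ih =>
      have hstep : z * g (m + 1) = g m := by
        have hrec := hy m
        field_simp at hrec
        simp only [hg]
        linear_combination hrec
      rw [← ih, ← hstep, pow_succ, mul_assoc]
  have hglim : Filter.Tendsto g Filter.atTop (nhds 0) := by
    simpa using (hlim.comp (Filter.tendsto_add_atTop_nat 1)).sub (hlim.const_mul z)
  have hg0 : g 0 = 0 := by
    refine tendsto_nhds_unique (f := fun m => z ^ m * g m) (l := Filter.atTop) ?_
      (squeeze_zero_norm (fun m => ?_) (tendsto_zero_iff_norm_tendsto_zero.1 hglim))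
    · simp only [hinvariant, tendsto_const_nhds]
    · rw [norm_mul, norm_pow]
      exact mul_le_of_le_one_left (norm_nonneg _) (pow_le_one₀ (norm_nonneg _) hz1)
  have hstep (m : ℕ) : y (m + 1) = z * y m := by
    have hgm : g m = 0 := by simpa [hg0, hz0] using hinvariant m
    exact sub_eq_zero.1 hgm
  induction m with
  | zero => simp
  | succ m ih => rw [hstep, ih, pow_succ']; ring

end Recurrence

section Ray

variable {V : Type*} [DecidableEq V] {G : SimpleGraph V}

theorem eigenfunction_coupling_ray_iff (hG : UniformlyLocallyFinite G) (v : V) {z : ℂ}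
    (hz0 : z ≠ 0) (hz1 : ‖z‖ ≤ 1) (f : EllTwo (V ⊕ ℕ)) :
    (∀ u, adjFun (coupling G ray v 0) f u = (z + z⁻¹) * f u) ↔
      (∀ m, f (Sum.inr m) = f (Sum.inl v) * z ^ (m + 1)) ∧
        ∀ x, adjFun G (f ∘ Sum.inl) x + (Pi.single v (f (Sum.inl v) * z) : V → ℂ) x =
          (z + z⁻¹) * f (Sum.inl x) := by
  have hdecay : Filter.Tendsto (fun m => f (Sum.inr m)) Filter.atTop (nhds 0) :=
    Nat.cofinite_eq_atTop ▸ (tendsto_cofinite_zero f).comp Sum.inr_injective.tendsto_cofinite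
  simp only [Sum.forall, adjFun_coupling_inl hG, adjFun_coupling_inr uniformlyLocallyFinite_ray]
  constructor
  · rintro ⟨hinl, hinr⟩
    let y : ℕ → ℂ := fun m => Nat.casesOn m (f (Sum.inl v)) fun i => f (Sum.inr i)
    have hrec (m : ℕ) : y m + y (m + 2) = (z + z⁻¹) * y (m + 1) := by
      cases m with
      | zero =>
        change f (Sum.inl v) + f (Sum.inr 1) = (z + z⁻¹) * f (Sum.inr 0)
        simpa [adjFun_ray_zero, add_comm] using hinr 0
      | succ m => simpa [adjFun_ray_succ] using hinr (m + 1)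
    have hlim : Filter.Tendsto y Filter.atTop (nhds 0) :=
      (Filter.tendsto_add_atTop_iff_nat 1).1 hdecay
    have hray (m : ℕ) : f (Sum.inr m) = f (Sum.inl v) * z ^ (m + 1) :=
      eq_mul_pow_of_tendsto_zero hz0 hz1 hrec hlim (m + 1)
    refine ⟨hray, fun x => ?_⟩
    rw [← hinl x, hray 0, zero_add, pow_one]
  · rintro ⟨hray, hinl⟩
    refine ⟨fun x => ?_, fun m => ?_⟩
    · rw [← hinl x, hray 0, zero_add, pow_one]
    · have hpow (i : ℕ) : z ^ i + z ^ (i + 2) = (z + z⁻¹) * z ^ (i + 1) :=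
        isPathSolution_pow hz0 (i + 1) i i.lt_succ_self
      rcases m with _ | m
      · rw [adjFun_ray_zero, Pi.single_eq_same, Function.comp_apply, hray, hray]
        linear_combination f (Sum.inl v) * hpow 0
      · rw [adjFun_ray_succ, Pi.single_eq_of_ne m.succ_ne_zero, Function.comp_apply,
          Function.comp_apply, hray, hray, hray]
        linear_combination f (Sum.inl v) * hpow (m + 1)

end Ray

section PetalProfile

/-- The solution of the eigenvalue equation `x i + x (i + 2) = (z + z⁻¹) * x (i + 1)` with value
`1` at both end points `0` and `k + 1`. Indices beyond `k + 1` carry no meaning, because of the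
truncated subtraction. -/
def petalProfile {K : Type*} [Field K] (k : ℕ) (z : K) (i : ℕ) : K :=
  (z ^ i + z ^ (k + 1 - i)) / (1 + z ^ (k + 1))

theorem isPathSolution_petalProfile {K : Type*} [Field K] {z : K} (hz : z ≠ 0) (k : ℕ) :
    IsPathSolution (z + z⁻¹) k (petalProfile k z) := fun i hi => by
  obtain ⟨m, rfl⟩ := Nat.exists_eq_add_of_lt hi
  have h0 : i + m + 1 + 1 - i = m + 2 := by omega
  have h1 : i + m + 1 + 1 - (i + 1) = m + 1 := by omega
  have h2 : i + m + 1 + 1 - (i + 2) = m := by omega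
  simp only [petalProfile, h0, h1, h2, ← add_div, ← mul_div_assoc]
  congr 1
  field_simp
  ring

theorem petalProfile_last {K : Type*} [Field K] (k : ℕ) (z : K) :
    petalProfile k z k = petalProfile k z 1 := by
  simp [petalProfile, add_comm]

theorem ofReal_petalProfile (k : ℕ) (z : ℝ) (i : ℕ) :
    ((petalProfile k z i : ℝ) : ℂ) = petalProfile k (z : ℂ) i := by
  simp [petalProfile]

variable {𝕜 : Type*} [NormedField 𝕜] {z : 𝕜}

theorem one_add_pow_ne_zero (hz1 : ‖z‖ < 1) {m : ℕ} (hm : m ≠ 0) : 1 + z ^ m ≠ 0 := fun h => by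
  have hnorm : ‖z‖ ^ m = 1 := by rw [← norm_pow, eq_neg_of_add_eq_zero_right h, norm_neg, norm_one]
  exact (pow_lt_one₀ (norm_nonneg z) hz1 hm).ne hnorm

theorem pow_sub_inv_pow_ne_zero (hz0 : z ≠ 0) (hz1 : ‖z‖ < 1) {m : ℕ} (hm : m ≠ 0) :
    z ^ m - z⁻¹ ^ m ≠ 0 := by
  refine sub_ne_zero.2 fun h => ?_
  have hlt : ‖z ^ m‖ < ‖z⁻¹ ^ m‖ := by
    rw [norm_pow, norm_pow, norm_inv]
    exact (pow_lt_one₀ (norm_nonneg z) hz1 hm).trans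
      (one_lt_pow₀ ((one_lt_inv₀ (norm_pos_iff.2 hz0)).2 hz1) hm)
  exact hlt.ne (congrArg norm h)

theorem petalProfile_zero (hz1 : ‖z‖ < 1) (k : ℕ) : petalProfile k z 0 = 1 := by
  rw [petalProfile, pow_zero, Nat.sub_zero, div_self (one_add_pow_ne_zero hz1 k.succ_ne_zero)]

theorem petalProfile_add_one (hz1 : ‖z‖ < 1) (k : ℕ) : petalProfile k z (k + 1) = 1 := by
  rw [petalProfile, Nat.sub_self, pow_zero, add_comm,
    div_self (one_add_pow_ne_zero hz1 k.succ_ne_zero)]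

theorem IsPathSolution.eq_mul_petalProfile (hz0 : z ≠ 0) (hz1 : ‖z‖ < 1) {k : ℕ} {x : ℕ → 𝕜}
    (hx : IsPathSolution (z + z⁻¹) k x) (hxk : x (k + 1) = x 0) {i : ℕ} (hi : i ≤ k + 1) :
    x i = x 0 * petalProfile k z i := by
  have hdirichlet : IsPathSolution (z + z⁻¹) k fun i => z ^ i - z⁻¹ ^ i := by
    refine (isPathSolution_pow hz0 k).sub ?_
    simpa only [inv_inv, add_comm] using isPathSolution_pow (inv_ne_zero hz0) k
  refine hdirichlet.eqOn_of_boundary (by simp) (pow_sub_inv_pow_ne_zero hz0 hz1 k.succ_ne_zero) hx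
    ((isPathSolution_petalProfile hz0 k).const_mul (x 0)) ?_ ?_ hi
  · rw [petalProfile_zero hz1, mul_one]
  · rw [petalProfile_add_one hz1, mul_one, hxk]

end PetalProfile

section Flower

variable {n : ℕ} {k : Fin n → ℕ}

/-- The values of `f` read along the `j`-th petal; position `0` is the root, and so is position
`k j + 1`, because positions are taken modulo `k j + 1`. -/
def petalSeq (f : FlowerVertex k → ℂ) (j : Fin n) (i : ℕ) : ℂ :=
  f (petal k j (Fin.ofNat (k j + 1) i))

theorem petalSeq_zero (f : FlowerVertex k → ℂ) (j : Fin n) : petalSeq f j 0 = f none := rfl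

theorem petalSeq_add_card (f : FlowerVertex k → ℂ) (j : Fin n) (i : ℕ) :
    petalSeq f j (i + (k j + 1)) = petalSeq f j i := by
  rw [petalSeq, petalSeq]
  congr 2
  exact Fin.ext (Nat.add_mod_right _ _)

theorem petal_ofNat_succ (j : Fin n) (i : Fin (k j)) :
    petal k j (Fin.ofNat (k j + 1) (i + 1)) = some ⟨j, i⟩ := by
  have hi : Fin.ofNat (k j + 1) (i + 1) = i.succ := Fin.ext (Nat.mod_eq_of_lt (by simp))
  rw [hi]
  rfl

theorem petalSeq_succ (f : FlowerVertex k → ℂ) (j : Fin n) (i : Fin (k j)) :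
    petalSeq f j (i + 1) = f (some ⟨j, i⟩) :=
  congrArg f (petal_ofNat_succ j i)

theorem eq_zero_of_petal_eq_petal {j l : Fin n} (hjl : j ≠ l) {a : Fin (k j + 1)}
    {b : Fin (k l + 1)} (h : petal k j a = petal k l b) : a = 0 := by
  cases a using Fin.cases with
  | zero => rfl
  | succ a =>
    cases b using Fin.cases with
    | zero => cases h
    | succ b => exact absurd (congrArg Sigma.fst (Option.some.inj h)) hjl

theorem pairwise_disjoint_map_petal (G : ∀ j, SimpleGraph (Fin (k j + 1))) :
    Pairwise (Function.onFun Disjoint fun j => (G j).map (petal k j)) := by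
  refine fun j l hjl => SimpleGraph.disjoint_left.2 fun u v hj hl => ?_
  obtain ⟨a, b, hab, rfl, rfl⟩ := (SimpleGraph.map_adj _ _ _ _).1 hj
  obtain ⟨c, d, -, hc, hd⟩ := (SimpleGraph.map_adj _ _ _ _).1 hl
  apply hab.ne
  rw [eq_zero_of_petal_eq_petal hjl hc.symm, eq_zero_of_petal_eq_petal hjl hd.symm]

theorem adjFun_flower (f : FlowerVertex k → ℂ) (v : FlowerVertex k) :
    adjFun (flower k) f v =
      ∑ j, adjFun ((SimpleGraph.cycleGraph (k j + 1)).map (petal k j)) f v :=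
  adjFun_iSup (fun _ => uniformlyLocallyFinite_of_finite _) (pairwise_disjoint_map_petal _) f v

theorem adjFun_map_petal {j : Fin n} (hk : 2 ≤ k j) (f : FlowerVertex k → ℂ) (i : ℕ) :
    adjFun ((SimpleGraph.cycleGraph (k j + 1)).map (petal k j)) f
      (petal k j (Fin.ofNat (k j + 1) (i + 1))) = petalSeq f j i + petalSeq f j (i + 2) := by
  rw [adjFun_map, adjFun_cycleGraph hk]
  rfl

theorem adjFun_flower_none (hk : ∀ j, 2 ≤ k j) (f : FlowerVertex k → ℂ) :
    adjFun (flower k) f none = ∑ j, (petalSeq f j (k j) + petalSeq f j 1) := by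
  rw [adjFun_flower]
  refine Finset.sum_congr rfl fun j _ => ?_
  have hroot : petal k j (Fin.ofNat (k j + 1) (k j + 1)) = none := by
    rw [Fin.ofNat_self]
    rfl
  rw [← hroot, adjFun_map_petal (hk j), ← petalSeq_add_card f j 1, add_comm 1]

theorem adjFun_flower_some {j : Fin n} (hk : 2 ≤ k j) (f : FlowerVertex k → ℂ) (i : Fin (k j)) :
    adjFun (flower k) f (some ⟨j, i⟩) = petalSeq f j i + petalSeq f j (i + 2) := by
  rw [adjFun_flower, Finset.sum_eq_single j, ← petal_ofNat_succ, adjFun_map_petal hk]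
  · rintro l - hl
    refine adjFun_map_of_notMem_range _ _ fun ⟨a, ha⟩ => ?_
    exact i.succ_ne_zero (eq_zero_of_petal_eq_petal hl.symm ha.symm)
  · simp

theorem isPathSolution_petalSeq_iff {j : Fin n} (hk : 2 ≤ k j) {l : ℂ}
    {f : FlowerVertex k → ℂ} :
    IsPathSolution l (k j) (petalSeq f j) ↔
      ∀ i : Fin (k j), adjFun (flower k) f (some ⟨j, i⟩) = l * f (some ⟨j, i⟩) := by
  simp only [adjFun_flower_some hk, ← petalSeq_succ f j, Fin.forall_iff]
  rfl

theorem isPathSolution_petalSeq_iff_eq_mul_petalProfile {z : ℂ} (hz0 : z ≠ 0) (hz1 : ‖z‖ < 1)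
    {f : FlowerVertex k → ℂ} {j : Fin n} :
    IsPathSolution (z + z⁻¹) (k j) (petalSeq f j) ↔
      ∀ i ≤ k j + 1, petalSeq f j i = f none * petalProfile (k j) z i := by
  constructor
  · intro h i hi
    refine h.eq_mul_petalProfile hz0 hz1 ?_ hi
    simpa only [zero_add] using petalSeq_add_card f j 0
  · intro h i hi
    rw [h i (by omega), h (i + 1) (by omega), h (i + 2) (by omega)]
    exact (isPathSolution_petalProfile hz0 (k j)).const_mul (f none) i hi

theorem forall_le_petalSeq_eq_iff {z : ℂ} (hz1 : ‖z‖ < 1) {f : FlowerVertex k → ℂ} {j : Fin n} :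
    (∀ i ≤ k j + 1, petalSeq f j i = f none * petalProfile (k j) z i) ↔
      ∀ i : Fin (k j), f (some ⟨j, i⟩) = f none * petalProfile (k j) z (i + 1) := by
  simp only [← petalSeq_succ f j]
  refine ⟨fun h i => h (i + 1) (by omega), fun h i hi => ?_⟩
  rcases i with _ | i
  · rw [petalSeq_zero, petalProfile_zero hz1, mul_one]
  rcases (Nat.le_of_succ_le_succ hi).lt_or_eq with hi | rfl
  · exact h ⟨i, hi⟩
  · rw [petalProfile_add_one hz1, mul_one, ← petalSeq_zero f j, ← petalSeq_add_card f j 0, zero_add]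

theorem flower_root_potential_iff (hk : ∀ j, 2 ≤ k j) {z : ℂ} (hz0 : z ≠ 0) (hz1 : ‖z‖ < 1)
    (f : FlowerVertex k → ℂ) :
    (∀ x, adjFun (flower k) f x + (Pi.single none (f none * z) : FlowerVertex k → ℂ) x =
        (z + z⁻¹) * f x) ↔
      (∀ j, ∀ i : Fin (k j), f (some ⟨j, i⟩) = f none * petalProfile (k j) z (i + 1)) ∧
        f none * (2 * ∑ j, petalProfile (k j) z 1) = f none * z⁻¹ := by
  simp only [Option.forall, Sigma.forall, Pi.single_apply, reduceCtorEq, if_false, if_true,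
    add_zero, ← isPathSolution_petalSeq_iff (hk _),
    isPathSolution_petalSeq_iff_eq_mul_petalProfile hz0 hz1, ← forall_le_petalSeq_eq_iff hz1]
  refine and_comm.trans (and_congr_right fun hprofile => ?_)
  have hroot : adjFun (flower k) f none = f none * (2 * ∑ j, petalProfile (k j) z 1) := by
    rw [adjFun_flower_none hk, Finset.mul_sum, Finset.mul_sum]
    refine Finset.sum_congr rfl fun j _ => ?_
    rw [hprofile j _ (k j).le_succ, hprofile j 1 (by omega), petalProfile_last]
    ring
  rw [hroot, add_comm z, add_mul, mul_comm z, add_left_inj, mul_comm z⁻¹]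

end Flower

section Eigenspace

variable {n : ℕ} {k : Fin n → ℕ} {z : ℂ}

/-- The adjacency operator of the flower with a ray, with its boundedness forgotten. -/
noncomputable def flowerOperator (k : Fin n → ℕ) : Module.End ℂ (EllTwo (FlowerVertex k ⊕ ℕ)) :=
  (adjacencyOperator (flowerWithRay k) (uniformlyLocallyFinite_flowerWithRay k)).toLinearMap

/-- The candidate eigenfunction for the eigenvalue `z + z⁻¹`, normalized to `1` at the root: the
symmetric solution on every petal and the decaying solution on the ray. -/
noncomputable def flowerEigenfun (k : Fin n → ℕ) (z : ℂ) : FlowerVertex k ⊕ ℕ → ℂ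
  | Sum.inl none => 1
  | Sum.inl (some ⟨j, i⟩) => petalProfile (k j) z (i + 1)
  | Sum.inr m => z ^ (m + 1)

theorem memℓp_flowerEigenfun (k : Fin n → ℕ) (hz1 : ‖z‖ < 1) :
    Memℓp (flowerEigenfun k z) 2 := by
  refine memℓp_gen (Summable.sum _ (Summable.of_finite) ?_)
  have hgeom : Summable fun m : ℕ => (‖z‖ ^ 2) ^ (m + 1) :=
    (summable_nat_add_iff 1).2 <|
      summable_geometric_of_lt_one (sq_nonneg _) (pow_lt_one₀ (norm_nonneg z) hz1 two_ne_zero)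
  refine hgeom.congr fun m => ?_
  simp [flowerEigenfun, pow_right_comm]

theorem eq_smul_flowerEigenfun_iff {f : FlowerVertex k ⊕ ℕ → ℂ} :
    f = f (Sum.inl none) • flowerEigenfun k z ↔
      (∀ m, f (Sum.inr m) = f (Sum.inl none) * z ^ (m + 1)) ∧ ∀ j, ∀ i : Fin (k j),
        f (Sum.inl (some ⟨j, i⟩)) = f (Sum.inl none) * petalProfile (k j) z (i + 1) := by
  rw [funext_iff]
  simp [Sum.forall, Option.forall, Sigma.forall, flowerEigenfun, and_comm]

theorem mem_eigenspace_flowerOperator_iff (hk : ∀ j, 2 ≤ k j) (hz0 : z ≠ 0) (hz1 : ‖z‖ < 1)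
    (f : EllTwo (FlowerVertex k ⊕ ℕ)) :
    f ∈ Module.End.eigenspace (flowerOperator k) (z + z⁻¹) ↔
      f = f (Sum.inl none) • flowerEigenfun k z ∧
        f (Sum.inl none) * (2 * ∑ j, petalProfile (k j) z 1) = f (Sum.inl none) * z⁻¹ := by
  rw [flowerOperator, mem_eigenspace_adjacencyOperator_iff, flowerWithRay,
    eigenfunction_coupling_ray_iff (uniformlyLocallyFinite_of_finite _) _ hz0 hz1.le,
    eq_smul_flowerEigenfun_iff, and_assoc]
  exact and_congr_right' (flower_root_potential_iff hk hz0 hz1 (f ∘ Sum.inl))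

theorem hasEigenvalue_flowerOperator_iff (hk : ∀ j, 2 ≤ k j) (hz0 : z ≠ 0) (hz1 : ‖z‖ < 1) :
    Module.End.HasEigenvalue (flowerOperator k) (z + z⁻¹) ↔
      2 * ∑ j, petalProfile (k j) z 1 = z⁻¹ := by
  constructor
  · intro h
    obtain ⟨f, hf, hne⟩ := h.exists_hasEigenvector
    obtain ⟨hmul, hroot⟩ := (mem_eigenspace_flowerOperator_iff hk hz0 hz1 f).1 hf
    refine mul_left_cancel₀ (fun h0 => hne (lp.ext ?_)) hroot
    rw [hmul, h0, zero_smul]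
    rfl
  · intro h
    let E : EllTwo (FlowerVertex k ⊕ ℕ) := ⟨flowerEigenfun k z, memℓp_flowerEigenfun k hz1⟩
    have hE : E (Sum.inl none) = 1 := rfl
    refine Module.End.hasEigenvalue_of_hasEigenvector (x := E)
      ⟨(mem_eigenspace_flowerOperator_iff hk hz0 hz1 E).2 ⟨?_, by rw [h]⟩, fun h0 => ?_⟩
    · rw [hE, one_smul]
    · exact one_ne_zero (hE.symm.trans (congrArg (fun f : EllTwo _ => f (Sum.inl none)) h0))

theorem finiteDimensional_eigenspace_flowerOperator (hk : ∀ j, 2 ≤ k j) (hz0 : z ≠ 0)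
    (hz1 : ‖z‖ < 1) :
    FiniteDimensional ℂ (Module.End.eigenspace (flowerOperator k) (z + z⁻¹)) := by
  let E : EllTwo (FlowerVertex k ⊕ ℕ) := ⟨flowerEigenfun k z, memℓp_flowerEigenfun k hz1⟩
  refine Submodule.finiteDimensional_of_le (S₂ := ℂ ∙ E) fun f hf => ?_
  exact Submodule.mem_span_singleton.2 ⟨f (Sum.inl none),
    lp.ext ((mem_eigenspace_flowerOperator_iff hk hz0 hz1 f).1 hf).1.symm⟩

end Eigenspace

section DiscreteSpectrum

variable {n : ℕ} {k : Fin n → ℕ}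

theorem two_lt_abs_add_inv {z : ℝ} (hz0 : z ≠ 0) (hz1 : |z| < 1) : 2 < |z + z⁻¹| := by
  have hne : z - z⁻¹ ≠ 0 := by
    simpa only [pow_one] using pow_sub_inv_pow_ne_zero hz0 hz1 one_ne_zero
  have hsq : (z + z⁻¹) ^ 2 = 2 ^ 2 + (z - z⁻¹) ^ 2 := by
    field_simp
    ring
  refine lt_of_pow_lt_pow_left₀ 2 (abs_nonneg _) ?_
  rw [sq_abs, hsq]
  exact lt_add_of_pos_right _ (sq_pos_of_ne_zero hne)

theorem ofReal_mem_flowerDiscreteSpectrum_iff (hk : ∀ j, 2 ≤ k j) {z : ℝ} (hz0 : z ≠ 0)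
    (hz1 : |z| < 1) :
    ((z + z⁻¹ : ℝ) : ℂ) ∈ flowerDiscreteSpectrum k ↔
      2 * ∑ j, petalProfile (k j) z 1 = z⁻¹ := by
  have hz0' : (z : ℂ) ≠ 0 := Complex.ofReal_ne_zero.2 hz0
  have hz1' : ‖(z : ℂ)‖ < 1 := by rwa [Complex.norm_real]
  have hband : ((z + z⁻¹ : ℝ) : ℂ) ∉ (fun x : ℝ => (x : ℂ)) '' Set.Icc (-2) 2 := by
    rw [Complex.ofReal_injective.mem_set_image, Set.mem_Icc, ← abs_le, not_le]
    exact two_lt_abs_add_inv hz0 hz1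
  calc ((z + z⁻¹ : ℝ) : ℂ) ∈ flowerDiscreteSpectrum k
      ↔ Module.End.HasEigenvalue (flowerOperator k) ((z : ℂ) + (z : ℂ)⁻¹) := by
        push_cast at hband ⊢
        exact ⟨fun h => h.1,
          fun h => ⟨h, finiteDimensional_eigenspace_flowerOperator hk hz0' hz1', hband⟩⟩
    _ ↔ 2 * ∑ j, petalProfile (k j) z 1 = z⁻¹ := by
        rw [hasEigenvalue_flowerOperator_iff hk hz0' hz1']
        simp only [← ofReal_petalProfile]
        norm_cast

theorem exists_ofReal_of_mem_flowerDiscreteSpectrum {l : ℂ} (hl : l ∈ flowerDiscreteSpectrum k) :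
    ∃ x : ℝ, l = x ∧ 2 < |x| := by
  obtain ⟨heigen, -, hband⟩ := hl
  obtain ⟨x, rfl⟩ := exists_ofReal_eq_of_hasEigenvalue _ heigen
  refine ⟨x, rfl, ?_⟩
  rwa [Complex.ofReal_injective.mem_set_image, Set.mem_Icc, ← abs_le, not_le] at hband

/-- The equation for `t` under which `2 * ε * cosh t` is an eigenvalue; the sign `ε` is `1` or
`-1`. -/
def SecularEquation (k : Fin n → ℕ) (ε t : ℝ) : Prop :=
  2 * ∑ j, (Real.sinh (k j * t) + ε ^ (k j + 1) * Real.sinh t) / Real.sinh ((k j + 1) * t) =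
    Real.exp t

theorem inv_mul_exp_neg {ε : ℝ} (hε : ε ^ 2 = 1) (t : ℝ) :
    (ε * Real.exp (-t))⁻¹ = ε * Real.exp t := by
  rw [mul_inv, Real.exp_neg, inv_inv, inv_eq_of_mul_eq_one_left (by rwa [← sq])]

theorem abs_mul_of_sq_eq_one {ε : ℝ} (hε : ε ^ 2 = 1) (q : ℝ) : |ε * q| = |q| :=
  (sq_eq_sq_iff_abs_eq_abs _ _).1 (by rw [mul_pow, hε, one_mul])

theorem abs_mul_exp_neg_lt_one {ε : ℝ} (hε : ε ^ 2 = 1) {t : ℝ} (ht : 0 < t) :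
    |ε * Real.exp (-t)| < 1 := by
  rwa [abs_mul_of_sq_eq_one hε, Real.abs_exp, Real.exp_lt_one_iff, neg_lt_zero]

theorem mul_exp_neg_ne_zero {ε : ℝ} (hε : ε ^ 2 = 1) (t : ℝ) : ε * Real.exp (-t) ≠ 0 :=
  mul_ne_zero (left_ne_zero_of_mul_eq_one ((sq ε).symm.trans hε)) (Real.exp_ne_zero _)

theorem petalProfile_one_mul {K : Type*} [Field K] {ε q : K} (hε : ε ^ 2 = 1) (hq : q ≠ 0) {k : ℕ}
    (hden : 1 + (ε * q) ^ (k + 1) ≠ 0) (hdiff : (q ^ (k + 1))⁻¹ - q ^ (k + 1) ≠ 0) :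
    petalProfile k (ε * q) 1 =
      ε * (((q ^ k)⁻¹ - q ^ k + ε ^ (k + 1) * (q⁻¹ - q)) / ((q ^ (k + 1))⁻¹ - q ^ (k + 1))) := by
  have hsign : (ε ^ (k + 1)) ^ 2 = 1 := by rw [← pow_mul', pow_mul, hε, one_pow]
  have hpow : ε ^ k = ε * ε ^ (k + 1) := by linear_combination -ε ^ k * hε
  rw [petalProfile, pow_one, Nat.add_sub_cancel, ← mul_div_assoc, div_eq_div_iff hden hdiff,
    mul_pow, mul_pow, hpow]
  generalize ε ^ (k + 1) = s at hsign
  field_simp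
  linear_combination ε * q ^ 2 * (q ^ k) ^ 3 * (q ^ 2 - 1) * hsign

theorem petalProfile_one_mul_exp_neg {ε : ℝ} (hε : ε ^ 2 = 1) (k : ℕ) {t : ℝ} (ht : 0 < t) :
    petalProfile k (ε * Real.exp (-t)) 1 =
      ε * ((Real.sinh (k * t) + ε ^ (k + 1) * Real.sinh t) / Real.sinh ((k + 1) * t)) := by
  have hsinh (m : ℕ) : (Real.exp (-t) ^ m)⁻¹ - Real.exp (-t) ^ m = 2 * Real.sinh (m * t) := by
    rw [← Real.exp_nat_mul, ← Real.exp_neg, Real.sinh_eq]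
    ring_nf
  have hsinh_one : (Real.exp (-t))⁻¹ - Real.exp (-t) = 2 * Real.sinh t := by
    simpa only [pow_one, Nat.cast_one, one_mul] using hsinh 1
  have hsinh_pos : 0 < Real.sinh ((k + 1 : ℕ) * t) := Real.sinh_pos_iff.2 (by positivity)
  rw [petalProfile_one_mul hε (Real.exp_ne_zero _)
    (one_add_pow_ne_zero (abs_mul_exp_neg_lt_one hε ht) k.succ_ne_zero)
    (by rw [hsinh]; exact (mul_pos two_pos hsinh_pos).ne'), hsinh, hsinh, hsinh_one,
    mul_left_comm (ε ^ _), ← mul_add, mul_div_mul_left _ _ two_ne_zero, Nat.cast_succ]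

theorem secularEquation_iff {ε : ℝ} (hε : ε ^ 2 = 1) {t : ℝ} (ht : 0 < t) :
    SecularEquation k ε t ↔
      2 * ∑ j, petalProfile (k j) (ε * Real.exp (-t)) 1 = (ε * Real.exp (-t))⁻¹ := by
  have hε0 : ε ≠ 0 := left_ne_zero_of_mul_eq_one ((sq ε).symm.trans hε)
  simp only [petalProfile_one_mul_exp_neg hε _ ht, ← Finset.mul_sum, inv_mul_exp_neg hε,
    mul_left_comm _ ε, mul_right_inj' hε0]
  rfl

theorem two_mul_cosh_mem_flowerDiscreteSpectrum_iff (hk : ∀ j, 2 ≤ k j) {ε : ℝ} (hε : ε ^ 2 = 1)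
    {t : ℝ} (ht : 0 < t) :
    ((2 * ε * Real.cosh t : ℝ) : ℂ) ∈ flowerDiscreteSpectrum k ↔ SecularEquation k ε t := by
  have hcosh : 2 * ε * Real.cosh t = ε * Real.exp (-t) + (ε * Real.exp (-t))⁻¹ := by
    rw [inv_mul_exp_neg hε, Real.cosh_eq]
    ring
  rw [hcosh, secularEquation_iff hε ht, ofReal_mem_flowerDiscreteSpectrum_iff hk
    (mul_exp_neg_ne_zero hε t) (abs_mul_exp_neg_lt_one hε ht)]

theorem exists_eq_two_mul_cosh {x : ℝ} (hx : 2 < |x|) :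
    ∃ ε t : ℝ, (ε = 1 ∨ ε = -1) ∧ 0 < t ∧ x = 2 * ε * Real.cosh t := by
  have hcosh : 2 * Real.cosh (Real.arcosh (|x| / 2)) = |x| := by
    rw [Real.cosh_arcosh (by linarith)]
    ring
  rcases abs_choice x with h | h
  · exact ⟨1, _, Or.inl rfl, Real.arcosh_pos (x := |x| / 2) (by linarith), by linarith⟩
  · exact ⟨-1, _, Or.inr rfl, Real.arcosh_pos (x := |x| / 2) (by linarith), by linarith⟩

theorem mem_flowerDiscreteSpectrum_iff (hk : ∀ j, 2 ≤ k j) {l : ℂ} :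
    l ∈ flowerDiscreteSpectrum k ↔ ∃ ε t : ℝ, (ε = 1 ∨ ε = -1) ∧
      (0 < t ∧ SecularEquation k ε t) ∧ l = ((2 * ε * Real.cosh t : ℝ) : ℂ) := by
  constructor
  · intro hl
    obtain ⟨x, rfl, hx⟩ := exists_ofReal_of_mem_flowerDiscreteSpectrum hl
    obtain ⟨ε, t, hε, ht, rfl⟩ := exists_eq_two_mul_cosh hx
    exact ⟨ε, t, hε, ⟨ht, (two_mul_cosh_mem_flowerDiscreteSpectrum_iff hk
      (sq_eq_one_iff.2 hε) ht).1 hl⟩, rfl⟩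
  · rintro ⟨ε, t, hε, ⟨ht, hsec⟩, rfl⟩
    exact (two_mul_cosh_mem_flowerDiscreteSpectrum_iff hk (sq_eq_one_iff.2 hε) ht).2 hsec

end DiscreteSpectrum

section SecularUniqueness

theorem one_sub_pow_div_one_sub_pow_strictMonoOn {a b : ℕ} (ha : 0 < a) (hab : a < b) :
    StrictMonoOn (fun q : ℝ => (1 - q ^ b) / (1 - q ^ a)) (Set.Ico 0 1) := by
  -- the quotient is a secant slope at `1` of the strictly convex function `v ↦ v ^ (b / a)`
  intro x hx y hy hxy
  have ha' : (0 : ℝ) < a := Nat.cast_pos.2 ha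
  have hpow {q : ℝ} (hq : 0 ≤ q) : (q ^ a) ^ (b / a : ℝ) = q ^ b := by
    rw [← Real.rpow_natCast_mul hq, mul_div_cancel₀ _ ha'.ne', Real.rpow_natCast]
  have hconvex := strictConvexOn_rpow (p := b / a) ((one_lt_div ha').2 (Nat.cast_lt.2 hab))
  have hslope := hconvex.secant_strict_mono (a := 1) (x := x ^ a) (y := y ^ a)
    (Set.mem_Ici.2 zero_le_one) (pow_nonneg hx.1 a) (pow_nonneg hy.1 a)
    (pow_lt_one₀ hx.1 hx.2 ha.ne').ne (pow_lt_one₀ hy.1 hy.2 ha.ne').ne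
    (pow_lt_pow_left₀ hxy hx.1 ha.ne')
  simp only [Real.one_rpow, hpow hx.1, hpow hy.1] at hslope
  simpa only [← neg_sub (1 : ℝ), neg_div_neg_eq] using hslope

theorem one_sub_sq_div_strictAntiOn {m : ℕ} (hm : 2 < m) {s : ℝ} (hs : s = 1 ∨ s = -1) :
    StrictAntiOn (fun q : ℝ => (1 - q ^ 2) / (1 + s * q ^ m)) (Set.Ico 0 1) := by
  have hpos {q : ℝ} (hq : q ∈ Set.Ico (0 : ℝ) 1) {i : ℕ} (hi : i ≠ 0) : 0 < 1 - q ^ i :=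
    sub_pos.2 (pow_lt_one₀ hq.1 hq.2 hi)
  intro x hx y hy hxy
  obtain ⟨hx0, -⟩ := id hx
  rcases hs with rfl | rfl
  · have hnum : 0 < 1 - x ^ 2 := hpos hx two_ne_zero
    simp only [one_mul]
    gcongr
  · have hmono := one_sub_pow_div_one_sub_pow_strictMonoOn two_pos hm hx hy hxy
    have hinv := inv_strictAnti₀ (div_pos (hpos hx (by omega)) (hpos hx two_ne_zero)) hmono
    simpa only [inv_div, neg_one_mul, ← sub_eq_add_neg] using hinv

/-- The contribution of a petal with `k + 1` vertices to the secular equation, in the form in which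
that equation reads `∑ j, petalWeight (k j) z = 1 / 2`. -/
def petalWeight {K : Type*} [Field K] (k : ℕ) (z : K) : K :=
  (z ^ 2 + z ^ (k + 1)) / (1 + z ^ (k + 1))

theorem mul_petalProfile_one {K : Type*} [Field K] (k : ℕ) (z : K) :
    z * petalProfile k z 1 = petalWeight k z := by
  rw [petalProfile, petalWeight, Nat.add_sub_cancel, ← mul_div_assoc]
  ring_nf

theorem petalWeight_eq_one_sub {𝕜 : Type*} [NormedField 𝕜] {z : 𝕜} (hz1 : ‖z‖ < 1) (k : ℕ) :
    petalWeight k z = 1 - (1 - z ^ 2) / (1 + z ^ (k + 1)) := by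
  have hden : 1 + z ^ (k + 1) ≠ 0 := one_add_pow_ne_zero hz1 k.succ_ne_zero
  rw [petalWeight, one_sub_div hden]
  ring_nf

theorem petalWeight_le_petalWeight {z : ℝ} (hz1 : |z| < 1) {k m : ℕ}
    (h : z ^ (m + 1) ≤ z ^ (k + 1)) : petalWeight m z ≤ petalWeight k z := by
  have hsq : 0 ≤ 1 - z ^ 2 := sub_nonneg.2 ((sq_lt_one_iff_abs_lt_one z).2 hz1).le
  have hpos : 0 < 1 + z ^ (m + 1) := by
    have hlt : |z ^ (m + 1)| < 1 := abs_pow z _ ▸ pow_lt_one₀ (abs_nonneg z) hz1 m.succ_ne_zero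
    linarith [(abs_lt.1 hlt).1]
  rw [petalWeight_eq_one_sub hz1, petalWeight_eq_one_sub hz1]
  gcongr

theorem sq_le_petalWeight {z : ℝ} (hz0 : 0 ≤ z) (hz1 : z < 1) (k : ℕ) :
    z ^ 2 ≤ petalWeight k z := by
  rw [petalWeight, le_div_iff₀ (by positivity)]
  have := mul_le_of_le_one_left (pow_nonneg hz0 (k + 1)) (pow_le_one₀ hz0 hz1.le (n := 2))
  linarith

theorem petalWeight_mul_strictMonoOn {k : ℕ} (hk : 2 ≤ k) {ε : ℝ} (hε : ε = 1 ∨ ε = -1) :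
    StrictMonoOn (fun q => petalWeight k (ε * q)) (Set.Ico 0 1) := by
  have hsq : ε ^ 2 = 1 := sq_eq_one_iff.2 hε
  have hsign : ε ^ (k + 1) = 1 ∨ ε ^ (k + 1) = -1 :=
    sq_eq_one_iff.1 (by rw [← pow_mul', pow_mul, hsq, one_pow])
  have hweight : ∀ q ∈ Set.Ico (0 : ℝ) 1,
      petalWeight k (ε * q) = 1 - (1 - q ^ 2) / (1 + ε ^ (k + 1) * q ^ (k + 1)) := by
    intro q hq
    have hq1 : |ε * q| < 1 := by rw [abs_mul_of_sq_eq_one hsq, abs_of_nonneg hq.1]; exact hq.2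
    rw [petalWeight_eq_one_sub hq1, mul_pow, mul_pow, hsq, one_mul]
  intro x hx y hy hxy
  simp only [hweight x hx, hweight y hy]
  exact sub_lt_sub_left (one_sub_sq_div_strictAntiOn (by omega) hsign hx hy hxy) 1

variable {n : ℕ} {k : Fin n → ℕ}

theorem secularEquation_iff_sum_petalWeight {ε : ℝ} (hε : ε ^ 2 = 1) {t : ℝ} (ht : 0 < t) :
    SecularEquation k ε t ↔ ∑ j, petalWeight (k j) (ε * Real.exp (-t)) = 1 / 2 := by
  rw [secularEquation_iff hε ht, ← mul_eq_one_iff_eq_inv₀ (mul_exp_neg_ne_zero hε t), mul_assoc,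
    Finset.sum_mul, eq_div_iff two_ne_zero, mul_comm (2 : ℝ)]
  simp only [mul_comm _ (ε * Real.exp (-t)), mul_petalProfile_one]

theorem sum_petalWeight_strictMonoOn [NeZero n] (hk : ∀ j, 2 ≤ k j) {ε : ℝ}
    (hε : ε = 1 ∨ ε = -1) :
    StrictMonoOn (fun q => ∑ j, petalWeight (k j) (ε * q)) (Set.Ico 0 1) := fun _ hx _ hy hxy =>
  Finset.sum_lt_sum_of_nonempty Finset.univ_nonempty fun j _ =>
    petalWeight_mul_strictMonoOn (hk j) hε hx hy hxy

theorem continuousOn_sum_petalWeight {ε : ℝ} (hε : ε ^ 2 = 1) :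
    ContinuousOn (fun q => ∑ j, petalWeight (k j) (ε * q)) (Set.Ico 0 1) := by
  refine continuousOn_finsetSum _ fun j _ => ContinuousOn.div (by fun_prop) (by fun_prop) ?_
  intro q hq
  refine one_add_pow_ne_zero ?_ (k j).succ_ne_zero
  rw [Real.norm_eq_abs, abs_mul_of_sq_eq_one hε, abs_of_nonneg hq.1]
  exact hq.2

theorem exists_forall_secularEquation_iff [NeZero n] (hk : ∀ j, 2 ≤ k j) {ε : ℝ}
    (hε : ε = 1 ∨ ε = -1) {r : ℝ} (hr : r ∈ Set.Ico (0 : ℝ) 1)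
    (hlarge : 1 / 2 < ∑ j, petalWeight (k j) (ε * r)) :
    ∃ t₀ : ℝ, ∀ t, 0 < t ∧ SecularEquation k ε t ↔ t = t₀ := by
  have hzero : ∑ j, petalWeight (k j) (ε * 0) = 0 := by simp [petalWeight]
  obtain ⟨q, hq, hroot⟩ : ∃ q ∈ Set.Icc 0 r, ∑ j, petalWeight (k j) (ε * q) = 1 / 2 :=
    intermediate_value_Icc hr.1 ((continuousOn_sum_petalWeight (sq_eq_one_iff.2 hε)).mono
      (Set.Icc_subset_Ico_right hr.2)) ⟨hzero.trans_le one_half_pos.le, hlarge.le⟩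
  have hq0 : 0 < q := by
    refine hq.1.lt_of_ne ?_
    rintro rfl
    exact one_half_pos.ne (hzero.symm.trans hroot)
  have hq1 : q < 1 := hq.2.trans_lt hr.2
  refine ⟨-Real.log q, fun t => ⟨fun ⟨ht, hsec⟩ => ?_, ?_⟩⟩
  · rw [secularEquation_iff_sum_petalWeight (sq_eq_one_iff.2 hε) ht, ← hroot] at hsec
    have hexp : Real.exp (-t) = q := (sum_petalWeight_strictMonoOn hk hε).injOn
      ⟨Real.exp_nonneg _, Real.exp_lt_one_iff.2 (neg_neg_of_pos ht)⟩ ⟨hq0.le, hq1⟩ hsec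
    rw [← hexp, Real.log_exp, neg_neg]
  · rintro rfl
    have ht : 0 < -Real.log q := neg_pos.2 (Real.log_neg hq0 hq1)
    rw [secularEquation_iff_sum_petalWeight (sq_eq_one_iff.2 hε) ht, neg_neg, Real.exp_log hq0]
    exact ⟨ht, hroot⟩

theorem mul_le_sum_petalWeight {c z : ℝ} (h : ∀ j, c ≤ petalWeight (k j) z) :
    n * c ≤ ∑ j, petalWeight (k j) z := by
  simpa using Finset.card_nsmul_le_sum Finset.univ _ c fun j _ => h j

theorem one_half_lt_sum_petalWeight_pos (hn : 1 ≤ n) (k : Fin n → ℕ) :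
    1 / 2 < ∑ j, petalWeight (k j) (1 * (9 / 10) : ℝ) := by
  have hn' : (1 : ℝ) ≤ n := Nat.one_le_cast.2 hn
  have := mul_le_sum_petalWeight (k := k) fun j =>
    sq_le_petalWeight (z := 1 * (9 / 10)) (by norm_num) (by norm_num) (k j)
  linarith

theorem odd_pow_le_pow {R : Type*} [Ring R] [LinearOrder R] [IsStrictOrderedRing R] {z : R}
    (hz0 : z ≤ 0) (hz1 : -1 ≤ z) {i m : ℕ} (hm : Odd m) (h : Even i ∨ m ≤ i) : z ^ m ≤ z ^ i := by
  rcases i.even_or_odd with hi | hi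
  · exact (hm.pow_nonpos hz0).trans (hi.pow_nonneg z)
  · have hmi : m ≤ i := h.resolve_left (Nat.not_even_iff_odd.2 hi)
    rw [← neg_le_neg_iff, ← hm.neg_pow, ← hi.neg_pow]
    exact pow_le_pow_of_le_one (neg_nonneg.2 hz0) (neg_le.1 hz1) hmi

-- Any base close enough to `-1` would do in place of `-9 / 10`: there the weight of a petal tends
-- to `1` if `k` is odd and to `1 - 2 / (k + 1)` if `k` is even, which is below `1 / 2` only for
-- `k = 2`.
theorem one_half_lt_sum_petalWeight_neg (hn : 1 ≤ n) (hk : ∀ j, 2 ≤ k j)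
    (hne : ¬(n = 1 ∧ ∀ j, k j = 2)) :
    1 / 2 < ∑ j, petalWeight (k j) (-1 * (9 / 10) : ℝ) := by
  rcases hn.eq_or_lt with rfl | hn
  · have hk0 : 3 ≤ k 0 := by
      refine (hk 0).lt_of_ne fun h => hne ⟨rfl, fun j => ?_⟩
      rw [Subsingleton.elim j 0, ← h]
    have hle : petalWeight 4 (-1 * (9 / 10) : ℝ) ≤ petalWeight (k 0) (-1 * (9 / 10) : ℝ) := by
      refine petalWeight_le_petalWeight (by norm_num [abs_of_pos]) ?_
      refine odd_pow_le_pow (by norm_num) (by norm_num) (by decide) ?_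
      grind
    rw [Fin.sum_univ_one]
    refine lt_of_lt_of_le ?_ hle
    norm_num [petalWeight]
  · have hn' : (2 : ℝ) ≤ n := Nat.ofNat_le_cast.2 hn
    have hle (j : Fin n) :
        petalWeight 2 (-1 * (9 / 10) : ℝ) ≤ petalWeight (k j) (-1 * (9 / 10) : ℝ) :=
      petalWeight_le_petalWeight (by norm_num [abs_of_pos]) <|
        odd_pow_le_pow (by norm_num) (by norm_num) (by decide) (Or.inr (Nat.succ_le_succ (hk j)))
    have hquarter : 1 / 4 < petalWeight 2 (-1 * (9 / 10) : ℝ) := by norm_num [petalWeight]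
    have := mul_le_sum_petalWeight hle
    nlinarith

end SecularUniqueness

end FlowerGraph

theorem mainTheorem3 (n : ℕ) (hn : 1 ≤ n) (k : Fin n → ℕ) (hk : ∀ j, 2 ≤ k j) :
    ∃ tp : ℝ,
      (∀ t : ℝ, (0 < t ∧
          2 * ∑ j, (Real.sinh (k j * t) + Real.sinh t) / Real.sinh ((k j + 1) * t) = Real.exp t)
        ↔ t = tp) ∧
      ((2 * Real.cosh tp : ℝ) : ℂ) ∈ FlowerGraph.flowerDiscreteSpectrum k ∧
      (¬ (n = 1 ∧ ∀ j, k j = 2) →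
        ∃ tm : ℝ,
          (∀ t : ℝ, (0 < t ∧
              2 * ∑ j, (Real.sinh (k j * t) + (-1) ^ (k j + 1) * Real.sinh t) /
                Real.sinh ((k j + 1) * t) = Real.exp t)
            ↔ t = tm) ∧
          FlowerGraph.flowerDiscreteSpectrum k =
            {((2 * Real.cosh tp : ℝ) : ℂ), ((-(2 * Real.cosh tm) : ℝ) : ℂ)}) := by
  have : NeZero n := ⟨Nat.one_le_iff_ne_zero.1 hn⟩
  obtain ⟨tp, htp⟩ := FlowerGraph.exists_forall_secularEquation_iff hk (Or.inl rfl) (by norm_num)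
    (FlowerGraph.one_half_lt_sum_petalWeight_pos hn k)
  refine ⟨tp, ?_, ?_, fun hne => ?_⟩
  · simpa only [FlowerGraph.SecularEquation, one_pow, one_mul] using htp
  · exact (FlowerGraph.mem_flowerDiscreteSpectrum_iff hk).2
      ⟨1, tp, Or.inl rfl, (htp tp).2 rfl, by rw [mul_one]⟩
  obtain ⟨tm, htm⟩ := FlowerGraph.exists_forall_secularEquation_iff hk (Or.inr rfl) (by norm_num)
    (FlowerGraph.one_half_lt_sum_petalWeight_neg hn hk hne)
  refine ⟨tm, htm, Set.ext fun l => ?_⟩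
  simp [FlowerGraph.mem_flowerDiscreteSpectrum_iff hk, or_and_right, exists_or, htp, htm]
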